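/- **Theorem 4.11 (Infinite Axiomatizability of $\langle\mathbb{Q}^+;\times\rangle$).** Let $\mathbb{Q}^+$ be the set of positive rational numbers. In the first-order language with equality whose symbols are a binary function symbol $\times$ (also written $\cdot$), a constant $\mathbf{1}$ and a unary function symbol $^{-1}$, and with $x^n$ abbreviating $x\cdot x\cdots x$ ($n$ times), let $T$ be the theory consisting of the following sentences: - ($\mathtt{M}_1$) $\forall x,y,z\,\big(x\cdot(y\cdot z)=(x\cdot y)\cdot z\big)$; - ($\mathtt{M}_2$) $\forall x\,\big(x\cdot\mathbf{1}=x\big)$; - ($\mathtt{M}_3^\circ$) $\forall x\,\big(x\cdot x^{-1}=\mathbf{1}\big)$; - ($\mathtt{M}_4$) $\forall x,y\,\big(x\cdot y=y\cdot x\big)$; - ($\mathtt{M}_{7,n}^\circ$) $\forall x\,\big(x^n=\mathbf{1}\rightarrow x=\mathbf{1}\big)$, for every integer $n\ge 1$; - ($\mathtt{M}_{16,n}$) $\forall v_1,\ldots,v_\ell\,\exists x\,\forall z\,\bigwedge_{k=1}^{\ell}\big(x^n\cdot v_k\neq z^{m_k}\big)$, for every integer $n\ge 1$, every $\ell\ge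 0$ and all positive integers $m_1,\ldots,m_\ell$ such that $m_1\nmid n,\ldots,m_\ell\nmid n$. Then $T$ completely axiomatizes the structure $\langle\mathbb{Q}^+;\times,\mathbf{1},{}^{-1}\rangle$ (with the usual operations): this structure is a model of $T$, the theory $T$ is complete, and the logical consequences of $T$ are exactly the first-order sentences of the language that are true in $\langle\mathbb{Q}^+;\times,\mathbf{1},{}^{-1}\rangle$. -/

import Mathlib

open FirstOrder FirstOrder.Language

/-- The function symbols: a binary `×`, a constant `𝟏` and a unary inverse. -/
inductive MulFunc : ℕ → Type
  | mul : MulFunc 2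
  | one : MulFunc 0
  | inv : MulFunc 1

/-- The first-order language with function symbols `×`, `𝟏`, `⁻¹` and, apart from equality,
no relation symbols. -/
def mulLang : FirstOrder.Language.{0, 0} where
  Functions := MulFunc
  Relations := fun _ => Empty

/-- The set of positive rational numbers. -/
abbrev QPos : Type := {q : ℚ // 0 < q}

/-- The structure `⟨ℚ⁺; ×, 𝟏, ⁻¹⟩`, with the usual operations. -/
instance QPos.mulStructure : mulLang.Structure QPos where
  funMap {_} f x :=
    match f, x with
    | MulFunc.mul, x => x 0 * x 1
    | MulFunc.one, _ => 1
    | MulFunc.inv, x => (x 0)⁻¹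
  RelMap {_} r _ := r.elim

namespace MulTerm

variable {α : Type}

/-- The term `s · t`. -/
def mul (s t : mulLang.Term α) : mulLang.Term α :=
  Functions.apply₂ (L := mulLang) MulFunc.mul s t

/-- The term `𝟏`. -/
def one : mulLang.Term α :=
  Constants.term (L := mulLang) MulFunc.one

/-- The term `t⁻¹`. -/
def inv (t : mulLang.Term α) : mulLang.Term α :=
  Functions.apply₁ (L := mulLang) MulFunc.inv t

/-- The term `t ^ n = t · t · … · t` (`n` times; the empty product is `𝟏`). -/
def pow (t : mulLang.Term α) : ℕ → mulLang.Term α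
  | 0 => one
  | 1 => t
  | n + 2 => mul (pow t (n + 1)) t

end MulTerm

namespace QPosAxiom

open MulTerm

/-- `∀ x y z, x · (y · z) = (x · y) · z`. -/
def mulAssoc : mulLang.Sentence :=
  ∀' ∀' ∀' (mul (&0) (mul (&1) (&2)) =' mul (mul (&0) (&1)) (&2))

/-- `∀ x, x · 𝟏 = x`. -/
def mulOne : mulLang.Sentence :=
  ∀' (mul (&0) one =' &0)

/-- `∀ x, x · x⁻¹ = 𝟏`. -/
def mulInv : mulLang.Sentence :=
  ∀' (mul (&0) (inv (&0)) =' one)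

/-- `∀ x y, x · y = y · x`. -/
def mulComm : mulLang.Sentence :=
  ∀' ∀' (mul (&0) (&1) =' mul (&1) (&0))

/-- `∀ x, (x ^ n = 𝟏 → x = 𝟏)`. -/
def torsionFree (n : ℕ) : mulLang.Sentence :=
  ∀' ((pow (&0) n =' one) ⟹ (&0 =' one))

/-- `∀ v₁ … v_ℓ, ∃ x, ∀ z, ⋀ₖ x ^ n · vₖ ≠ z ^ mₖ`. The variables `v₁, …, v_ℓ` have the
indices `0, …, ℓ - 1`, and `x` and `z` have the indices `ℓ` and `ℓ + 1`. -/
noncomputable def nonPower (n : ℕ) {l : ℕ} (m : Fin l → ℕ) : mulLang.Sentence :=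
  BoundedFormula.alls (n := l) (∃' ∀' BoundedFormula.iInf fun k : Fin l =>
    ∼(mul (pow (Term.var (Sum.inr (Fin.last l).castSucc)) n)
          (Term.var (Sum.inr k.castSucc.castSucc)) ='
        pow (Term.var (Sum.inr (Fin.last (l + 1)))) (m k)))

end QPosAxiom

/-- The axiom system: the axioms of abelian groups, torsion-freeness for every exponent `n ≥ 1`,
and all instances of the scheme `nonPower` with `n ≥ 1` and with (finitely many) positive
exponents `mₖ` none of which divides `n`. -/
def qPosTheory : mulLang.Theory :=
  {QPosAxiom.mulAssoc, QPosAxiom.mulOne, QPosAxiom.mulInv, QPosAxiom.mulComm} ∪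
  {φ | ∃ n : ℕ, 1 ≤ n ∧ φ = QPosAxiom.torsionFree n} ∪
  {φ | ∃ n : ℕ, 1 ≤ n ∧ ∃ (l : ℕ) (m : Fin l → ℕ), (∀ k, 1 ≤ m k ∧ ¬ m k ∣ n) ∧
    φ = QPosAxiom.nonPower n m}

/-! A model of the axioms is a torsion-free abelian group, written additively below, that satisfies
the non-power scheme. Two such models are compared by a graded back-and-forth: tuples agree to level
(L, B) if the same integer combinations are divisible by L and the same combinations with
coefficients bounded by B vanish. By `AgreeUpTo.exists_snoc`, agreement at a high enough level
extends by one element to a prescribed level. Hence, by induction on formulas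
(`exists_agreeUpTo_realize_iff`), each formula is decided by some level. Empty tuples always agree,
so any two models satisfy the same sentences; as ℚ⁺ is a model, the theorem follows. -/

/-! ### Torsion-free abelian groups with many non-multiples -/

section Groups

variable {G H : Type*} [AddCommGroup G] [AddCommGroup H]

/-- `u` is an integer multiple `m • g` of some element `g`. -/
def IsMultiple (m : ℤ) (u : G) : Prop := ∃ g : G, u = m • g

/-- The additive form of the axiom scheme `nonPower`. -/
def HasNonmultiples (G : Type*) [AddCommGroup G] : Prop :=
  ∀ (n : ℕ), 1 ≤ n → ∀ (l : ℕ) (m : Fin l → ℕ), (∀ k, 1 ≤ m k ∧ ¬ m k ∣ n) →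
    ∀ v : Fin l → G, ∃ x : G, ∀ z : G, ∀ k, n • x + v k ≠ m k • z

theorem IsMultiple.add {m : ℤ} {u v : G} (hu : IsMultiple m u) (hv : IsMultiple m v) :
    IsMultiple m (u + v) := by
  obtain ⟨g, rfl⟩ := hu
  obtain ⟨g', rfl⟩ := hv
  exact ⟨g + g', (smul_add _ _ _).symm⟩

theorem isMultiple_smul_self (m : ℤ) (u : G) : IsMultiple m (m • u) := ⟨u, rfl⟩

theorem isMultiple_add_iff {m : ℤ} {u v : G} (hv : IsMultiple m v) :
    IsMultiple m (u + v) ↔ IsMultiple m u := by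
  refine ⟨fun h => ?_, fun h => h.add hv⟩
  obtain ⟨g, hg⟩ := h
  obtain ⟨g', rfl⟩ := hv
  exact ⟨g - g', by rw [smul_sub, ← hg]; abel⟩

theorem IsMultiple.of_dvd {m m' : ℤ} {u : G} (h : IsMultiple m' u) (hm : m ∣ m') :
    IsMultiple m u := by
  obtain ⟨g, rfl⟩ := h
  obtain ⟨c, rfl⟩ := hm
  exact ⟨c • g, mul_smul _ _ _⟩

theorem IsMultiple.smul {m : ℤ} {u : G} (h : IsMultiple m u) (k : ℤ) : IsMultiple m (k • u) := by
  obtain ⟨g, rfl⟩ := h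
  exact ⟨k • g, smul_comm _ _ _⟩

theorem isMultiple_smul_iff [IsAddTorsionFree G] {k : ℤ} (hk : k ≠ 0) {m : ℤ} {u : G} :
    IsMultiple (k * m) (k • u) ↔ IsMultiple m u := by
  refine exists_congr fun g => ?_
  rw [mul_smul]
  exact (zsmul_right_injective hk).eq_iff

/-- Finitely many non-multiple conditions with different coefficients can be met at once. -/
theorem HasNonmultiples.exists_forall_not_isMultiple [IsAddTorsionFree G]
    (hG : HasNonmultiples G) {ι : Type*} [Finite ι] (n m : ι → ℤ) (v : ι → G)
    (hm : ∀ i, m i ≠ 0) (hmn : ∀ i, ¬ m i ∣ n i) :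
    ∃ w : G, ∀ i, ¬ IsMultiple (m i) (n i • w + v i) := by
  cases nonempty_fintype ι
  have hn : ∀ i, n i ≠ 0 := fun i h => hmn i (h ▸ dvd_zero _)
  -- The scheme has one exponent for all conditions, so condition `i` is scaled by `s i = N / n i`;
  -- torsion-freeness makes this reversible.
  let N : ℕ := ∏ i, (n i).natAbs
  have hN0 : N ≠ 0 := Finset.prod_ne_zero_iff.2 fun i _ => Int.natAbs_ne_zero.2 (hn i)
  have hdvd : ∀ i, ∃ s : ℤ, (N : ℤ) = n i * s := fun i =>
    Int.natAbs_dvd.1 (Int.natCast_dvd_natCast.2 (Finset.dvd_prod_of_mem _ (Finset.mem_univ i)))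
  choose s hs using hdvd
  have hs0 : ∀ i, s i ≠ 0 := fun i h => hN0 (by simpa [h] using hs i)
  let f := Fintype.equivFin ι
  obtain ⟨w, hw⟩ := hG N (Nat.one_le_iff_ne_zero.2 hN0) (Fintype.card ι)
    (fun k => (s (f.symm k) * m (f.symm k)).natAbs) (fun k => by
      refine ⟨Nat.one_le_iff_ne_zero.2 (Int.natAbs_ne_zero.2 (mul_ne_zero (hs0 _) (hm _))), ?_⟩
      intro h
      rw [← Int.natCast_dvd_natCast, Int.natAbs_dvd, hs (f.symm k), mul_comm (n _)] at h
      exact hmn _ (Int.dvd_of_mul_dvd_mul_left (hs0 _) h))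
    (fun k => s (f.symm k) • v (f.symm k))
  refine ⟨w, fun i hi => ?_⟩
  have h1 : IsMultiple ((s i * m i).natAbs : ℤ) (s i • (n i • w + v i)) :=
    ((isMultiple_smul_iff (hs0 i)).2 hi).of_dvd (Int.natAbs_dvd.2 dvd_rfl)
  obtain ⟨z, hz⟩ := h1
  refine hw z (f i) ?_
  simp only [Equiv.symm_apply_apply, ← natCast_zsmul]
  rw [← hz, hs i, smul_add, smul_smul, mul_comm]

/-! ### The back-and-forth relation -/

/-- The integer combination `∑ e i • a i`. -/
abbrev intComb {k : ℕ} (a : Fin k → G) : (Fin k → ℤ) →ₗ[ℤ] G := Fintype.linearCombination ℤ a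

theorem intComb_snoc {k : ℕ} (a : Fin k → G) (x : G) (e : Fin (k + 1) → ℤ) :
    intComb (Fin.snoc a x : Fin (k + 1) → G) e =
      e (Fin.last k) • x + intComb a (fun i => e i.castSucc) := by
  simp [intComb, Fintype.linearCombination_apply, Fin.sum_univ_castSucc, add_comm]

/-- Two tuples agree on divisibility by `L` of all integer combinations, and on the vanishing of
all integer combinations with coefficients bounded by `B`. -/
structure AgreeUpTo (L B : ℤ) {k : ℕ} (a : Fin k → G) (b : Fin k → H) : Prop where
  isMultiple_iff : ∀ e, IsMultiple L (intComb a e) ↔ IsMultiple L (intComb b e)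
  eq_zero_iff : ∀ e : Fin k → ℤ, (∀ i, |e i| ≤ B) → (intComb a e = 0 ↔ intComb b e = 0)

theorem AgreeUpTo.symm {L B : ℤ} {k : ℕ} {a : Fin k → G} {b : Fin k → H}
    (h : AgreeUpTo L B a b) : AgreeUpTo L B b a :=
  ⟨fun e => (h.1 e).symm, fun e he => (h.2 e he).symm⟩

/-- Scaling a combination by `L' / L` turns divisibility by `L` into divisibility by `L'`; this
relies on `isMultiple_iff` having no coefficient bound. -/
theorem AgreeUpTo.mono_left [IsAddTorsionFree G] [IsAddTorsionFree H] {L L' B : ℤ} {k : ℕ}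
    {a : Fin k → G} {b : Fin k → H} (h : AgreeUpTo L' B a b) (hL' : L' ≠ 0) (hL : L ∣ L') :
    AgreeUpTo L B a b := by
  refine ⟨fun e => ?_, h.2⟩
  obtain ⟨c, rfl⟩ := hL
  have hc : c ≠ 0 := right_ne_zero_of_mul hL'
  have := h.1 (c • e)
  rwa [mul_comm, map_smul, map_smul, isMultiple_smul_iff hc, isMultiple_smul_iff hc] at this

theorem AgreeUpTo.mono_right {L B B' : ℤ} {k : ℕ}
    {a : Fin k → G} {b : Fin k → H} (h : AgreeUpTo L B' a b) (hB : B ≤ B') :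
    AgreeUpTo L B a b :=
  ⟨h.1, fun e he => h.2 e fun i => (he i).trans hB⟩

theorem agreeUpTo_of_isEmpty (L B : ℤ) (a : Fin 0 → G) (b : Fin 0 → H) : AgreeUpTo L B a b := by
  refine ⟨fun e => ?_, fun e _ => ?_⟩ <;>
    simp only [intComb, Fintype.linearCombination_apply, Finset.univ_eq_empty, Finset.sum_empty]
  exact ⟨fun _ => ⟨0, by simp⟩, fun _ => ⟨0, by simp⟩⟩

/-! ### Extending agreeing tuples by one element -/

section Extension

variable {L B : ℤ} {k : ℕ} {a : Fin k → G} {b : Fin k → H}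

/-- Subtracting `j / d` times the relation `hx` leaves the coefficient `j % d`, which `hmin` forces
to be zero. So `d`, `f` and the tuple `a` determine all divisibility by `L` involving `x`. -/
theorem isMultiple_smul_add_iff_of_order {x : G} {d : ℤ} (hd : 0 < d)
    {f : Fin k → ℤ} (hx : IsMultiple L (d • x + intComb a f))
    (hmin : ∀ r : ℤ, 0 < r → r < d → ∀ e : Fin k → ℤ, ¬ IsMultiple L (r • x + intComb a e))
    (j : ℤ) (e : Fin k → ℤ) :
    IsMultiple L (j • x + intComb a e) ↔
      d ∣ j ∧ IsMultiple L (intComb a (e - (j / d) • f)) := by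
  have key : j • x + intComb a e =
      ((j % d) • x + intComb a (e - (j / d) • f)) + (j / d) • (d • x + intComb a f) := by
    rw [map_sub, map_smul]
    nth_rewrite 1 [← Int.emod_add_mul_ediv j d]
    module
  rw [key, isMultiple_add_iff (hx.smul _)]
  constructor
  · intro h
    have h0 : j % d = 0 := by
      by_contra hne
      exact hmin _ (lt_of_le_of_ne (Int.emod_nonneg _ hd.ne') (Ne.symm hne))
        (Int.emod_lt_of_pos _ hd) _ h
    refine ⟨Int.dvd_of_emod_eq_zero h0, ?_⟩
    rwa [h0, zero_smul, zero_add] at h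
  · rintro ⟨hdj, h⟩
    rwa [Int.emod_eq_zero_of_dvd hdj, zero_smul, zero_add]

/-- For `L ≠ 0` this leaves finitely many `e` to consider, as the non-power scheme requires. -/
theorem isMultiple_add_intComb_emod_iff {u : G} (e : Fin k → ℤ) :
    IsMultiple L (u + intComb a (fun i => e i % L)) ↔ IsMultiple L (u + intComb a e) := by
  have : e = (fun i => e i % L) + L • (fun i => e i / L) := by
    ext i; simp [Int.emod_add_mul_ediv]
  conv_rhs => rw [this, map_add, map_smul, ← add_assoc]
  exact (isMultiple_add_iff (isMultiple_smul_self _ _)).symm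

variable [IsAddTorsionFree G] [IsAddTorsionFree H]

/-- Dependent case: the relation makes `c` divide `intComb a f`, hence also `intComb b f`, which
yields the new element. Multiplying by `c` then eliminates it on both sides: the modulus becomes `c
* L`, and coefficients bounded by `B` grow to at most `2 * B * B`. -/
theorem AgreeUpTo.exists_snoc_of_eq_zero {L' B' : ℤ} (hB' : 2 * B * B ≤ B')
    (h : AgreeUpTo L' B' a b) (hL' : L' ≠ 0) {c : ℤ} (hc : c ≠ 0) (hcB : |c| ≤ B)
    (hcL : c * L ∣ L') {f : Fin k → ℤ} (hf : ∀ i, |f i| ≤ B) {x : G}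
    (hx : c • x + intComb a f = 0) :
    ∃ y : H, AgreeUpTo L B (Fin.snoc a x : Fin (k + 1) → G) (Fin.snoc b y : Fin (k + 1) → H) := by
  have hcx : intComb a f = c • (-x) := by
    rw [smul_neg, eq_neg_iff_add_eq_zero, add_comm]; exact hx
  obtain ⟨y, hy⟩ := ((h.mono_left hL' (dvd_of_mul_right_dvd hcL)).1 f).1 ⟨-x, hcx⟩
  have keyG : ∀ (j : ℤ) (e : Fin k → ℤ),
      c • (j • x + intComb a e) = intComb a (c • e - j • f) := fun j e => by
    rw [map_sub, map_smul, map_smul, hcx]; module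
  have keyH : ∀ (j : ℤ) (e : Fin k → ℤ),
      c • (j • (-y) + intComb b e) = intComb b (c • e - j • f) := fun j e => by
    rw [map_sub, map_smul, map_smul, hy]; module
  refine ⟨-y, fun e => ?_, fun e he => ?_⟩
  · rw [intComb_snoc, intComb_snoc, ← isMultiple_smul_iff hc, keyG,
      ← isMultiple_smul_iff (G := H) hc, keyH]
    exact (h.mono_left hL' hcL).1 _
  · rw [intComb_snoc, intComb_snoc, ← smul_eq_zero_iff_right hc, keyG,
      ← smul_eq_zero_iff_right (M := H) hc, keyH]
    refine h.2 _ fun i => ?_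
    have h0 : 0 ≤ B := (abs_nonneg _).trans hcB
    have h1 : |c * e i.castSucc| ≤ B * B := by
      rw [abs_mul]; exact mul_le_mul hcB (he _) (abs_nonneg _) h0
    have h2 : |e (Fin.last k) * f i| ≤ B * B := by
      rw [abs_mul]; exact mul_le_mul (he _) (hf _) (abs_nonneg _) h0
    have h3 := abs_sub (c * e i.castSucc) (e (Fin.last k) * f i)
    simp only [Pi.sub_apply, Pi.smul_apply, smul_eq_mul]
    linarith

/-- Independent case: `y` must avoid small relations, and divisibility by `L` is governed by the
least `d > 0` for which some `d • x + intComb a f` is a multiple of `L`. With `L = d * q` and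
`intComb b f = d • g`, every `y = -g + q • w` satisfies the copied relation; the scheme supplies a
`w` that keeps `d` minimal and avoids the small relations. -/
theorem AgreeUpTo.exists_snoc_of_forall_ne_zero (hH : HasNonmultiples H) (hL : 0 < L)
    (h : AgreeUpTo L B a b) {x : G}
    (hx : ∀ c : ℤ, c ≠ 0 → |c| ≤ B → ∀ f : Fin k → ℤ, (∀ i, |f i| ≤ B) →
      c • x + intComb a f ≠ 0) :
    ∃ y : H, AgreeUpTo L B (Fin.snoc a x : Fin (k + 1) → G) (Fin.snoc b y : Fin (k + 1) → H) := by
  classical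
  have hex : ∃ d : ℕ, 0 < d ∧ ∃ f : Fin k → ℤ, IsMultiple L ((d : ℤ) • x + intComb a f) := by
    refine ⟨L.toNat, by omega, 0, ?_⟩
    rw [map_zero, add_zero, Int.toNat_of_nonneg hL.le]
    exact isMultiple_smul_self _ _
  obtain ⟨hd, f, hf⟩ := Nat.find_spec hex
  have hmin : ∀ r : ℤ, 0 < r → r < (Nat.find hex : ℕ) → ∀ e : Fin k → ℤ,
      ¬ IsMultiple L (r • x + intComb a e) := by
    intro r hr hrd e he
    refine Nat.find_min hex (m := r.toNat) (by omega) ⟨by omega, e, ?_⟩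
    rwa [Int.toNat_of_nonneg hr.le]
  generalize Nat.find hex = d' at hd hf hmin
  obtain ⟨d, rfl⟩ : ∃ d : ℤ, d = d' := ⟨_, rfl⟩
  have hd : 0 < (d' : ℤ) := by exact_mod_cast hd
  generalize (d' : ℤ) = d at hd hf hmin
  have hdL : d ∣ L := by
    have := (isMultiple_smul_add_iff_of_order hd hf hmin L 0).1
      (by rw [map_zero, add_zero]; exact isMultiple_smul_self _ _)
    exact this.1
  have hfa : IsMultiple d (intComb a f) := by
    have := hf.of_dvd hdL
    rwa [add_comm, isMultiple_add_iff (isMultiple_smul_self _ _)] at this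
  obtain ⟨g, hg⟩ := ((h.mono_left hL.ne' hdL).1 f).1 hfa
  obtain ⟨q, rfl⟩ := hdL
  have hq : q ≠ 0 := right_ne_zero_of_mul hL.ne'
  -- `I₁` indexes the conditions keeping `d` minimal for `y`, with `e` reduced modulo `L`; `I₂`
  -- indexes the small relations to avoid.
  let I₁ := Set.Icc (1 : ℤ) (d - 1) × Set.Icc (0 : Fin k → ℤ) (fun _ => d * q)
  let I₂ := {c : Set.Icc (-B) B // (c : ℤ) ≠ 0} × Set.Icc (fun _ : Fin k => -B) (fun _ => B)
  obtain ⟨w, hw⟩ := hH.exists_forall_not_isMultiple (ι := I₁ ⊕ I₂)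
    (Sum.elim (fun i => (i.1 : ℤ) * q) (fun i => (i.1.1 : ℤ) * q))
    -- Nonvanishing is strengthened to non-divisibility by `2cq`, which cannot divide the
    -- coefficient `cq` of `w`.
    (Sum.elim (fun _ => d * q) (fun i => ((i.1.1 : ℤ) * q) * 2))
    (Sum.elim (fun i => (i.1 : ℤ) • (-g) + intComb b i.2)
      (fun i => (i.1.1 : ℤ) • (-g) + intComb b i.2))
    (by
      rintro (i | i)
      · exact hL.ne'
      · exact mul_ne_zero (mul_ne_zero i.1.2 hq) two_ne_zero)
    (by
      rintro (⟨⟨r, hr1, hr2⟩, e⟩ | ⟨⟨c, hc⟩, e⟩) hdvd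
      · have := Int.le_of_dvd (show 0 < r by omega) (Int.dvd_of_mul_dvd_mul_right hq hdvd)
        omega
      · simp only [Sum.elim_inr] at hdvd
        have h2 : (c : ℤ) * q * 2 ∣ (c : ℤ) * q * 1 := by simpa using hdvd
        have := Int.dvd_of_mul_dvd_mul_left (mul_ne_zero hc hq) h2
        omega)
  have hdy : IsMultiple (d * q) (d • (-g + q • w) + intComb b f) := ⟨w, by rw [hg]; module⟩
  have hminy : ∀ r : ℤ, 0 < r → r < d → ∀ e : Fin k → ℤ,
      ¬ IsMultiple (d * q) (r • (-g + q • w) + intComb b e) := by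
    intro r hr hrd e he
    rw [← isMultiple_add_intComb_emod_iff] at he
    refine hw (Sum.inl (⟨r, by omega, by omega⟩, ⟨fun i => e i % (d * q),
      fun i => Int.emod_nonneg _ hL.ne', fun i => (Int.emod_lt_of_pos _ hL).le⟩)) ?_
    simp only [Sum.elim_inl]
    convert he using 1
    module
  refine ⟨-g + q • w, fun e => ?_, fun e he => ?_⟩
  · rw [intComb_snoc, intComb_snoc, isMultiple_smul_add_iff_of_order hd hf hmin,
      isMultiple_smul_add_iff_of_order hd hdy hminy, h.1]
  · rw [intComb_snoc, intComb_snoc]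
    by_cases hc : e (Fin.last k) = 0
    · simpa [hc] using h.2 _ fun i => he i.castSucc
    · refine iff_of_false (hx _ hc (he _) _ fun i => he _) fun h0 => ?_
      refine hw (Sum.inr (⟨⟨e (Fin.last k), abs_le.1 (he _)⟩, hc⟩, ⟨fun i => e i.castSucc,
        fun i => (abs_le.1 (he _)).1, fun i => (abs_le.1 (he _)).2⟩)) ⟨0, ?_⟩
      simp only [Sum.elim_inr, smul_zero]
      rw [← h0]
      module

/-- The extension step of the back-and-forth argument. -/
theorem AgreeUpTo.exists_snoc (hH : HasNonmultiples H) (hL : 0 < L)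
    (h : AgreeUpTo (L * (B.toNat.factorial : ℤ)) (max B (2 * B * B)) a b) (x : G) :
    ∃ y : H, AgreeUpTo L B (Fin.snoc a x : Fin (k + 1) → G) (Fin.snoc b y : Fin (k + 1) → H) := by
  have hL' : L * (B.toNat.factorial : ℤ) ≠ 0 :=
    mul_ne_zero hL.ne' (Int.natCast_ne_zero.2 (Nat.factorial_ne_zero _))
  by_cases hx : ∀ c : ℤ, c ≠ 0 → |c| ≤ B → ∀ f : Fin k → ℤ, (∀ i, |f i| ≤ B) →
      c • x + intComb a f ≠ 0
  · exact ((h.mono_left hL' (dvd_mul_right _ _)).mono_right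
      (le_max_left _ _)).exists_snoc_of_forall_ne_zero hH hL hx
  · push Not at hx
    obtain ⟨c, hc, hcB, f, hf, hcf⟩ := hx
    -- A nonzero `c` with `|c| ≤ B` divides `B!`, so `c * L` divides the modulus of `h`.
    refine h.exists_snoc_of_eq_zero (le_max_right _ _) hL' hc hcB ?_ hf hcf
    rw [mul_comm]
    rw [Int.abs_eq_natAbs] at hcB
    refine mul_dvd_mul_left _ (Int.natAbs_dvd.1 (Int.natCast_dvd_natCast.2 ?_))
    exact Nat.dvd_factorial (Int.natAbs_pos.2 hc) (by omega)

end Extension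

end Groups

/-! ### Models as groups -/

section Models

variable {M : Type} [mulLang.Structure M]

theorem MulTerm.realize_mul {α : Type} (v : α → M) (s t : mulLang.Term α) :
    (MulTerm.mul s t).realize v =
      Structure.funMap (L := mulLang) MulFunc.mul ![s.realize v, t.realize v] :=
  Term.realize_functions_apply₂

theorem MulTerm.realize_one {α : Type} (v : α → M) :
    (MulTerm.one : mulLang.Term α).realize v =
      Structure.funMap (L := mulLang) MulFunc.one ![] := by
  simp only [MulTerm.one, Constants.term, Term.realize]
  congr 1
  exact Subsingleton.elim _ _

theorem MulTerm.realize_inv {α : Type} (v : α → M) (t : mulLang.Term α) :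
    (MulTerm.inv t).realize v = Structure.funMap (L := mulLang) MulFunc.inv ![t.realize v] :=
  Term.realize_functions_apply₁

open QPosAxiom

theorem qPosTheory_realize_mulAssoc [M ⊨ qPosTheory] : M ⊨ mulAssoc :=
  Theory.realize_sentence_of_mem qPosTheory (by simp [qPosTheory])

theorem qPosTheory_realize_mulOne [M ⊨ qPosTheory] : M ⊨ mulOne :=
  Theory.realize_sentence_of_mem qPosTheory (by simp [qPosTheory])

theorem qPosTheory_realize_mulInv [M ⊨ qPosTheory] : M ⊨ mulInv :=
  Theory.realize_sentence_of_mem qPosTheory (by simp [qPosTheory])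

theorem qPosTheory_realize_mulComm [M ⊨ qPosTheory] : M ⊨ mulComm :=
  Theory.realize_sentence_of_mem qPosTheory (by simp [qPosTheory])

theorem qPosTheory_realize_torsionFree [M ⊨ qPosTheory] {n : ℕ} (hn : 1 ≤ n) :
    M ⊨ torsionFree n :=
  Theory.realize_sentence_of_mem qPosTheory (Or.inl (Or.inr ⟨n, hn, rfl⟩))

theorem qPosTheory_realize_nonPower [M ⊨ qPosTheory] {n : ℕ} (hn : 1 ≤ n) {l : ℕ}
    {m : Fin l → ℕ} (hm : ∀ k, 1 ≤ m k ∧ ¬ m k ∣ n) : M ⊨ nonPower n m :=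
  Theory.realize_sentence_of_mem qPosTheory (Or.inr ⟨n, hn, l, m, hm, rfl⟩)

theorem realize_mulAssoc_iff : M ⊨ mulAssoc ↔ ∀ x y z : M,
    Structure.funMap (L := mulLang) MulFunc.mul
      ![x, Structure.funMap (L := mulLang) MulFunc.mul ![y, z] ] =
    Structure.funMap (L := mulLang) MulFunc.mul
      ![Structure.funMap (L := mulLang) MulFunc.mul ![x, y], z] := by
  simp [mulAssoc, Sentence.Realize, Formula.Realize, MulTerm.realize_mul, Fin.snoc]

theorem realize_mulOne_iff : M ⊨ mulOne ↔ ∀ x : M,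
    Structure.funMap (L := mulLang) MulFunc.mul
      ![x, Structure.funMap (L := mulLang) MulFunc.one ![] ] = x := by
  simp [mulOne, Sentence.Realize, Formula.Realize, MulTerm.realize_mul, MulTerm.realize_one,
    Fin.snoc]

theorem realize_mulInv_iff : M ⊨ mulInv ↔ ∀ x : M,
    Structure.funMap (L := mulLang) MulFunc.mul
      ![x, Structure.funMap (L := mulLang) MulFunc.inv ![x] ] =
    Structure.funMap (L := mulLang) MulFunc.one ![] := by
  simp [mulInv, Sentence.Realize, Formula.Realize, MulTerm.realize_mul, MulTerm.realize_one,
    MulTerm.realize_inv, Fin.snoc]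

theorem realize_mulComm_iff : M ⊨ mulComm ↔ ∀ x y : M,
    Structure.funMap (L := mulLang) MulFunc.mul ![x, y] =
    Structure.funMap (L := mulLang) MulFunc.mul ![y, x] := by
  simp [mulComm, Sentence.Realize, Formula.Realize, MulTerm.realize_mul, Fin.snoc]

/-- A model of the axioms of abelian groups, written additively. -/
abbrev addCommGroupOfModel (M : Type) [mulLang.Structure M] [M ⊨ qPosTheory] : AddCommGroup M :=
  letI : Add M := ⟨fun x y => Structure.funMap (L := mulLang) MulFunc.mul ![x, y]⟩
  letI : Zero M := ⟨Structure.funMap (L := mulLang) MulFunc.one ![]⟩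
  letI : Neg M := ⟨fun x => Structure.funMap (L := mulLang) MulFunc.inv ![x]⟩
  have hassoc : ∀ x y z : M, x + y + z = x + (y + z) := fun x y z =>
    (realize_mulAssoc_iff.1 qPosTheory_realize_mulAssoc x y z).symm
  have hcomm : ∀ x y : M, x + y = y + x := realize_mulComm_iff.1 qPosTheory_realize_mulComm
  have hzero : ∀ x : M, x + 0 = x := realize_mulOne_iff.1 qPosTheory_realize_mulOne
  have hneg : ∀ x : M, x + -x = 0 := realize_mulInv_iff.1 qPosTheory_realize_mulInv
  { add_assoc := hassoc
    zero_add := fun x => (hcomm _ _).trans (hzero x)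
    add_zero := hzero
    nsmul := nsmulRec
    zsmul := zsmulRec
    neg_add_cancel := fun x => (hcomm _ _).trans (hneg x)
    add_comm := hcomm }

/-- The group operations interpret the function symbols. -/
class IsAddInterpretation (M : Type) [mulLang.Structure M] [AddCommGroup M] : Prop where
  funMap_mul : ∀ x y : M, Structure.funMap (L := mulLang) MulFunc.mul ![x, y] = x + y
  funMap_one : Structure.funMap (L := mulLang) MulFunc.one ![] = (0 : M)
  funMap_inv : ∀ x : M, Structure.funMap (L := mulLang) MulFunc.inv ![x] = -x

section Interpretation

variable [AddCommGroup M] [IsAddInterpretation M]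

theorem MulTerm.realize_pow {α : Type} (v : α → M) (t : mulLang.Term α) :
    ∀ n : ℕ, (MulTerm.pow t n).realize v = n • t.realize v
  | 0 => by
    rw [MulTerm.pow, MulTerm.realize_one, IsAddInterpretation.funMap_one, zero_smul]
  | 1 => by rw [MulTerm.pow, one_smul]
  | n + 2 => by
    rw [MulTerm.pow, MulTerm.realize_mul, IsAddInterpretation.funMap_mul,
      MulTerm.realize_pow v t (n + 1), succ_nsmul _ (n + 1)]

theorem realize_torsionFree_iff {n : ℕ} :
    M ⊨ torsionFree n ↔ ∀ x : M, n • x = 0 → x = 0 := by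
  simp [torsionFree, Sentence.Realize, Formula.Realize, MulTerm.realize_pow, MulTerm.realize_one,
    IsAddInterpretation.funMap_one, Fin.snoc]

theorem realize_nonPower_iff {n l : ℕ} {m : Fin l → ℕ} :
    M ⊨ nonPower n m ↔
      ∀ v : Fin l → M, ∃ x : M, ∀ z : M, ∀ k, n • x + v k ≠ m k • z := by
  rw [nonPower, Sentence.Realize, BoundedFormula.realize_alls]
  simp [MulTerm.realize_pow, MulTerm.realize_mul, IsAddInterpretation.funMap_mul]

theorem isAddTorsionFree_of_model [M ⊨ qPosTheory] : IsAddTorsionFree M where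
  nsmul_right_injective n hn x y hxy := by
    have hxy : n • x = n • y := hxy
    rw [← sub_eq_zero]
    refine realize_torsionFree_iff.1
      (qPosTheory_realize_torsionFree (Nat.one_le_iff_ne_zero.2 hn)) _ ?_
    rw [smul_sub, hxy, sub_self]

theorem hasNonmultiples_of_model [M ⊨ qPosTheory] : HasNonmultiples M := fun _ hn _ _ hm =>
  realize_nonPower_iff.1 (qPosTheory_realize_nonPower hn hm)

end Interpretation

theorem isAddInterpretation_of_model (M : Type) [mulLang.Structure M] [M ⊨ qPosTheory] :
    letI := addCommGroupOfModel M
    IsAddInterpretation M :=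
  letI := addCommGroupOfModel M
  ⟨fun _ _ => rfl, rfl, fun _ => rfl⟩

/-! ### Formulas are decided by agreement -/

/-- The exponent vector of a term. -/
def MulTerm.exponents {k : ℕ} : mulLang.Term (Empty ⊕ Fin k) → Fin k → ℤ
  | .var (Sum.inr i) => Pi.single i 1
  | .func MulFunc.mul ts => exponents (ts 0) + exponents (ts 1)
  | .func MulFunc.one _ => 0
  | .func MulFunc.inv ts => -exponents (ts 0)

theorem MulTerm.realize_eq_intComb [AddCommGroup M] [IsAddInterpretation M] {k : ℕ}
    (v : Empty → M) (a : Fin k → M) (t : mulLang.Term (Empty ⊕ Fin k)) :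
    t.realize (Sum.elim v a) = intComb a (MulTerm.exponents t) := by
  induction t with
  | var i =>
    rcases i with i | i
    · exact i.elim
    · simp [MulTerm.exponents, intComb]
  | func f ts ih =>
    cases f with
    | mul =>
      rw [MulTerm.exponents, map_add, ← ih, ← ih]
      refine Eq.trans (congrArg (Structure.funMap (L := mulLang) _) ?_) (IsAddInterpretation.funMap_mul _ _)
      ext i; fin_cases i <;> rfl
    | one =>
      rw [MulTerm.exponents, map_zero]
      exact Eq.trans (congrArg (Structure.funMap (L := mulLang) _) (Subsingleton.elim _ _))
        IsAddInterpretation.funMap_one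
    | inv =>
      rw [MulTerm.exponents, map_neg, ← ih]
      refine Eq.trans (congrArg (Structure.funMap (L := mulLang) _) ?_) (IsAddInterpretation.funMap_inv _)
      ext i; fin_cases i; rfl

/-- Whether a formula holds at a tuple of a model is decided by finitely much divisibility
information. -/
theorem exists_agreeUpTo_realize_iff {k : ℕ} (φ : mulLang.BoundedFormula Empty k) :
    ∃ L B : ℤ, 0 < L ∧ ∀ (M N : Type) [mulLang.Structure M] [mulLang.Structure N]
      [AddCommGroup M] [AddCommGroup N] [IsAddInterpretation M] [IsAddInterpretation N]
      [IsAddTorsionFree M] [IsAddTorsionFree N], HasNonmultiples M → HasNonmultiples N →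
      ∀ (v : Empty → M) (w : Empty → N) (a : Fin k → M) (b : Fin k → N),
        AgreeUpTo L B a b → (φ.Realize v a ↔ φ.Realize w b) := by
  induction φ with
  | falsum => exact ⟨1, 0, one_pos, fun _ _ => by intros; rfl⟩
  | @equal k s t =>
    obtain ⟨B, hB⟩ : ∃ B : ℤ, ∀ i, |(MulTerm.exponents s - MulTerm.exponents t) i| ≤ B :=
      ⟨∑ j, |(MulTerm.exponents s - MulTerm.exponents t) j|, fun i =>
        Finset.single_le_sum (f := fun j => |(MulTerm.exponents s - MulTerm.exponents t) j|)
          (fun _ _ => abs_nonneg _) (Finset.mem_univ i)⟩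
    -- Equality of two terms is the vanishing of one combination; no divisibility enters, so the
    -- modulus is `1`.
    refine ⟨1, B, one_pos, ?_⟩
    intro M N _ _ _ _ _ _ _ _ _ _ v w a b h
    simp only [BoundedFormula.Realize, MulTerm.realize_eq_intComb]
    rw [← sub_eq_zero, ← map_sub, h.2 _ hB, map_sub, sub_eq_zero]
  | rel R => exact R.elim
  | imp φ ψ ihφ ihψ =>
    obtain ⟨L₁, B₁, hL₁, h₁⟩ := ihφ
    obtain ⟨L₂, B₂, hL₂, h₂⟩ := ihψ
    refine ⟨L₁ * L₂, max B₁ B₂, mul_pos hL₁ hL₂, ?_⟩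
    intro M N _ _ _ _ _ _ _ _ hM hN v w a b h
    have hne := (mul_pos hL₁ hL₂).ne'
    rw [BoundedFormula.realize_imp, BoundedFormula.realize_imp,
      h₁ M N hM hN v w a b ((h.mono_left hne (dvd_mul_right _ _)).mono_right (le_max_left _ _)),
      h₂ M N hM hN v w a b ((h.mono_left hne (dvd_mul_left _ _)).mono_right (le_max_right _ _))]
  | all φ ih =>
    obtain ⟨L, B, hL, hφ⟩ := ih
    refine ⟨L * (B.toNat.factorial : ℤ), max B (2 * B * B), by positivity, ?_⟩
    intro M N _ _ _ _ _ _ _ _ hM hN v w a b h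
    rw [BoundedFormula.realize_all, BoundedFormula.realize_all]
    constructor
    · intro hall y
      obtain ⟨x, hx⟩ := h.symm.exists_snoc hM hL y
      exact (hφ M N hM hN v w _ _ hx.symm).1 (hall x)
    · intro hall x
      obtain ⟨y, hy⟩ := h.exists_snoc hN hL x
      exact (hφ M N hM hN v w _ _ hy).2 (hall y)

theorem realize_iff_of_models (M N : Type) [mulLang.Structure M] [mulLang.Structure N]
    [M ⊨ qPosTheory] [N ⊨ qPosTheory] (φ : mulLang.Sentence) : M ⊨ φ ↔ N ⊨ φ := by
  let := addCommGroupOfModel M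
  let := addCommGroupOfModel N
  have := isAddInterpretation_of_model M
  have := isAddInterpretation_of_model N
  have : IsAddTorsionFree M := isAddTorsionFree_of_model
  have : IsAddTorsionFree N := isAddTorsionFree_of_model
  obtain ⟨L, B, _, h⟩ := exists_agreeUpTo_realize_iff φ
  exact h M N hasNonmultiples_of_model hasNonmultiples_of_model _ _ _ _
    (agreeUpTo_of_isEmpty _ _ _ _)

end Models

/-! ### The positive rationals -/

theorem MulTerm.realize_pow_qPos {α : Type} (v : α → QPos) (t : mulLang.Term α) :
    ∀ n : ℕ, (MulTerm.pow t n).realize v = t.realize v ^ n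
  | 0 => by rw [MulTerm.pow, MulTerm.realize_one, pow_zero]; rfl
  | 1 => by rw [MulTerm.pow, pow_one]
  | n + 2 => by
    rw [MulTerm.pow, MulTerm.realize_mul, MulTerm.realize_pow_qPos v t (n + 1), pow_succ _ (n + 1)]
    rfl

/-- Finitely many positive rationals avoid some prime. -/
theorem exists_prime_padicValRat_eq_zero {l : ℕ} (v : Fin l → QPos) :
    ∃ p : ℕ, p.Prime ∧ ∀ k, padicValRat p (v k).1 = 0 := by
  -- A prime exceeding every numerator and denominator divides none of them.
  obtain ⟨p, hle, hp⟩ := Nat.exists_infinite_primes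
    (∑ k, ((v k).1.num.natAbs + (v k).1.den) + 1)
  refine ⟨p, hp, fun k => ?_⟩
  have h1 : (v k).1.num.natAbs + (v k).1.den ≤ ∑ k, ((v k).1.num.natAbs + (v k).1.den) :=
    Finset.single_le_sum (f := fun k => (v k).1.num.natAbs + (v k).1.den)
      (fun _ _ => Nat.zero_le _) (Finset.mem_univ k)
  have h2 : 0 < (v k).1.num.natAbs := Int.natAbs_pos.2 (Rat.num_pos.2 (v k).2).ne'
  have h3 : 0 < (v k).1.den := (v k).1.den_pos
  rw [padicValRat, padicValInt, padicValNat.eq_zero_of_not_dvd, padicValNat.eq_zero_of_not_dvd]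
  · rfl
  · exact fun h => absurd (Nat.le_of_dvd h3 h) (by omega)
  · exact fun h => absurd (Nat.le_of_dvd h2 h) (by omega)

/-- A prime `p` occurring in no `v k` serves as `x`: the left side has `p`-adic valuation `n`, the
right side a multiple of `m k`. -/
theorem exists_forall_pow_mul_ne_pow {n l : ℕ} {m : Fin l → ℕ} (hm : ∀ k, ¬ m k ∣ n)
    (v : Fin l → QPos) : ∃ x : QPos, ∀ z : QPos, ∀ k, x ^ n * v k ≠ z ^ m k := by
  obtain ⟨p, hp, hv⟩ := exists_prime_padicValRat_eq_zero v
  have := Fact.mk hp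
  refine ⟨⟨p, by exact_mod_cast hp.pos⟩, fun z k h => hm k ?_⟩
  have h' : (p : ℚ) ^ n * (v k).1 = z.1 ^ m k := by
    simpa using congrArg Subtype.val h
  have hp0 : (p : ℚ) ≠ 0 := by exact_mod_cast hp.ne_zero
  have h2 := congrArg (padicValRat p) h'
  rw [padicValRat.mul (pow_ne_zero _ hp0) (v k).2.ne', padicValRat.pow,
    padicValRat.pow, hv k, padicValRat.self hp.one_lt, mul_one, add_zero] at h2
  exact Int.natCast_dvd_natCast.1 ⟨_, h2⟩

theorem qPos_models_qPosTheory : QPos ⊨ qPosTheory := by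
  rw [Theory.model_iff]
  rintro φ ((hφ | ⟨n, hn, rfl⟩) | ⟨n, hn, l, m, hm, rfl⟩)
  · simp only [Set.mem_insert_iff, Set.mem_singleton_iff] at hφ
    rcases hφ with rfl | rfl | rfl | rfl
    · exact realize_mulAssoc_iff.2 fun x y z => (mul_assoc x y z).symm
    · exact realize_mulOne_iff.2 fun x => mul_one x
    · exact realize_mulInv_iff.2 fun x => Subtype.ext (mul_inv_cancel₀ x.2.ne')
    · exact realize_mulComm_iff.2 fun x y => mul_comm x y
  · simp only [QPosAxiom.torsionFree, Sentence.Realize, Formula.Realize,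
      BoundedFormula.realize_all, BoundedFormula.realize_imp, BoundedFormula.realize_bdEqual,
      MulTerm.realize_pow_qPos]
    intro x hx
    rw [MulTerm.realize_one] at hx ⊢
    have hx' : x ^ n = 1 := hx
    refine Subtype.ext ?_
    exact (pow_eq_one_iff_of_nonneg x.2.le (Nat.one_le_iff_ne_zero.1 hn)).1 (by simpa using congrArg Subtype.val hx')
  · rw [QPosAxiom.nonPower, Sentence.Realize, BoundedFormula.realize_alls]
    intro v
    obtain ⟨x, hx⟩ := exists_forall_pow_mul_ne_pow (fun k => (hm k).2) v
    simp only [BoundedFormula.realize_ex, BoundedFormula.realize_all, BoundedFormula.realize_iInf,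
      BoundedFormula.realize_not, BoundedFormula.realize_bdEqual, MulTerm.realize_mul,
      MulTerm.realize_pow_qPos]
    refine ⟨x, fun z k => ?_⟩
    simp only [Term.realize_var, Sum.elim_inr, Fin.snoc_castSucc, Fin.snoc_last]
    exact hx z k

/-- The theory completely axiomatizes `⟨ℚ⁺; ×, 𝟏, ⁻¹⟩`: the structure is a model of it, it is
complete, and its consequences are exactly the sentences true in the structure. -/
theorem theorem4p11 :
    (QPos ⊨ qPosTheory) ∧ qPosTheory.IsComplete ∧
      {φ : mulLang.Sentence | qPosTheory ⊨ᵇ φ} = mulLang.completeTheory QPos := by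
  have := qPos_models_qPosTheory
  have key : ∀ φ : mulLang.Sentence, qPosTheory ⊨ᵇ φ ↔ QPos ⊨ φ := fun φ => by
    rw [Theory.models_sentence_iff]
    refine ⟨fun h => h (Theory.ModelType.of qPosTheory QPos), fun h M => ?_⟩
    exact (realize_iff_of_models M QPos φ).2 h
  refine ⟨inferInstance, ⟨Theory.Model.isSatisfiable QPos, fun φ => ?_⟩, ?_⟩
  · rw [key, key, Sentence.realize_not]
    exact em _
  · ext φ
    exact key φ
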